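/- Let $K$ be a field, $S=K[x_1,\dots,x_n]$, $\mathfrak m=(x_1,\dots,x_n)$, and let $I\subset S$ be a monomial ideal. Every such $I$ has an irredundant primary decomposition $I=\bigcap_{i=1}^{r}Q_i$ (with pairwise distinct radicals) in which all $Q_i$ are monomial ideals. Following Lyubeznik, for such a decomposition put $\operatorname{size}(I)=a+(n-b)-1$, where $a$ is the minimum number $t$ such that there are $j_1<\dots<j_t$ with $\sqrt{\sum_{l=1}^{t}Q_{j_l}}=\sqrt{\sum_{j=1}^{r}Q_j}$, and $b=\operatorname{height}\bigl(\sum_{j=1}^{r}Q_j\bigr)$. Let $\operatorname{depth}(I)$ be the supremum of the lengths of $I$-regular sequences in $\mathfrak m$, where $I$ is regarded as an $S$-module. The ideal $I$ has minimal depth if $\operatorname{depth}(I)=\operatorname{size}(I)+1$. Suppose that $\operatorname{Ass}(S/I)=\{P_1,\dots,P_s\}$ with $P_i\not\subseteq\sum_{j\ne i}P_j$ for all $i$ (an empty sum is $0$), and let $b=\operatorname{height}\bigl(\sum_{i=1}^{s}P_i\bigr)$. Then $\operatorname{size}(I)$ does not depend on the chosen decomposition, $b\le n$, $$\operatorname{size}(I)=s-1+(n-b),\qquad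 \operatorname{depth}(I)=s+(n-b),$$ so $I$ has minimal depth. In particular, if $\sum_{i=1}^{s}P_i=\mathfrak m$, then $\operatorname{size}(I)=s-1$ and $\operatorname{depth}(I)=s$. -/

import Mathlib

namespace MonomialDepth

variable {K : Type*} [Field K] {n : ℕ}

/-- An ideal of `K[x_1, …, x_n]` is monomial if it is generated by monomials. -/
def IsMonomialIdeal (I : Ideal (MvPolynomial (Fin n) K)) : Prop :=
  ∃ A : Set (Fin n →₀ ℕ),
    I = Ideal.span ((fun a => MvPolynomial.monomial a (1 : K)) '' A)

/-- `t` is (the set of components `Q_1, …, Q_s` of) an irredundant primary decomposition of `I`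
all of whose components are monomial ideals: the `Q_i` are primary with pairwise distinct radicals,
their intersection is `I`, and none of them can be omitted. -/
structure IsMonomialDecomposition (I : Ideal (MvPolynomial (Fin n) K))
    (t : Finset (Ideal (MvPolynomial (Fin n) K))) : Prop where
  isMinimal : Submodule.IsMinimalPrimaryDecomposition I t
  isMonomial : ∀ Q ∈ t, IsMonomialIdeal Q

/-- The number `a` in the definition of size: the least number of components (at least one) whose
sum has the same radical as the sum of all components. (Only for the empty family, the
decomposition of the unit ideal, there is no such number, and then the value is `0`.) -/
noncomputable def minSpanningNumber (t : Finset (Ideal (MvPolynomial (Fin n) K))) : ℕ :=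
  sInf {m : ℕ | ∃ u : Finset (Ideal (MvPolynomial (Fin n) K)), u ⊆ t ∧ u.Nonempty ∧ u.card = m ∧
    (∑ Q ∈ u, Q).radical = (∑ Q ∈ t, Q).radical}

/-- The number `a + (n - b) - 1` attached to a decomposition, where `b` is the height of the sum of
all components (always a finite number, because that sum is contained in `(x_1, …, x_n)`). -/
noncomputable def decompositionSize (t : Finset (Ideal (MvPolynomial (Fin n) K))) : ℤ :=
  (minSpanningNumber t : ℤ) + ((n : ℤ) - ((∑ Q ∈ t, Q).height.toNat : ℤ)) - 1

open Classical in
/-- The size of a monomial ideal (in the sense of Lyubeznik), computed from an irredundant primary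
decomposition with monomial components. -/
noncomputable def size (I : Ideal (MvPolynomial (Fin n) K)) : ℤ :=
  if h : ∃ t, IsMonomialDecomposition I t then decompositionSize h.choose else 0

/-- The depth of a module `M` over `S = K[x_1, …, x_n]`: the supremum of the lengths of
`M`-regular sequences contained in the graded maximal ideal `(x_1, …, x_n)`. -/
noncomputable def depth (M : Type*) [AddCommGroup M] [Module (MvPolynomial (Fin n) K) M] : ℕ∞ :=
  ⨆ (rs : List (MvPolynomial (Fin n) K))
    (_ : (∀ r ∈ rs, r ∈ MvPolynomial.idealOfVars (Fin n) K) ∧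
      RingTheory.Sequence.IsRegular M rs), (rs.length : ℕ∞)

/-- `I` has minimal depth if `depth I = size I + 1` (in particular the depth of `I` is finite). -/
def HasMinimalDepth (I : Ideal (MvPolynomial (Fin n) K)) : Prop :=
  ∃ d : ℕ, depth (K := K) (n := n) I = d ∧ (d : ℤ) = size I + 1

end MonomialDepth

/-!
Write `S = K[x_1, …, x_n]` and `𝔪 = (x_1, …, x_n)`. The associated primes of a monomial ideal are
generated by variables, so `P_i = (x_j : j ∈ F_i)`, and the hypothesis says that every `F_i`
contains an element that lies in no other `F_j`. The height of `∑ P_i` is `b = |⋃ F_i|`.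

*Size.* Replacing the components of an irredundant primary decomposition by the ideals generated by
the monomials in them gives a decomposition with monomial components
(`IsMonomialIdeal.exists_isMonomialDecomposition`). In any such decomposition the radicals of the
components are the `P_i`, and the radical of a sum of components is the sum of their radicals. By
the hypothesis no component can be omitted from the sum, so that `a = s` (`decompositionSize_eq`).

*Depth.* By Rees' theorem the depth of a nonzero ideal `I` is the least `d` with
`Ext^d(S/𝔪, I) ≠ 0` (`HasExtGrade.depth_eq`). For one component `Q`, primary to `(x_j : j ∈ F)`,
the `n - |F|` variables outside `F` form a regular sequence on `S/Q` with a quotient of finite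
length, so the depth of `S/Q` is `n - |F|` (`IsVarPrimary.hasExtGrade_quotient`), and that of `Q` is
`n - |F| + 1`. For several components induct on their number, with the exact sequence
`0 → J ∩ Q → J × Q → J + Q → 0`, where `Q` is one component, with radical `P`, and `J` is the
intersection of the others. As sums distribute over intersections of monomial ideals, `J + Q` is the
intersection of the `Q_i + Q`, which are primary to `P_i + P` and satisfy the hypothesis again, with
one component less and the same union of variables; so its depth is `s - 1 + (n - b)`. The depths of
`J` and `Q` are larger than that, and the long exact sequence gives the depth `s + (n - b)` for
`J ∩ Q` (`hasExtGrade_finset_inf`).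
-/

/-! ### Grade in terms of `Ext` -/

namespace MonomialDepth

section ExtGrade

open CategoryTheory Abelian

universe u

variable {R : Type u} [CommRing R]

variable (R) in
/-- The module `M` has grade `d` with respect to `N`: the groups `Ext^i(N, M)` vanish for `i < d`,
and `Ext^d(N, M)` does not. -/
def HasExtGrade (N M : Type u) [AddCommGroup N] [Module R N] [AddCommGroup M] [Module R M]
    (d : ℕ) : Prop :=
  (∀ i < d, Subsingleton (Ext (ModuleCat.of R N) (ModuleCat.of R M) i)) ∧
    Nontrivial (Ext (ModuleCat.of R N) (ModuleCat.of R M) d)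

variable {N M M' M'' : Type u} [AddCommGroup N] [Module R N] [AddCommGroup M] [Module R M]
  [AddCommGroup M'] [Module R M'] [AddCommGroup M''] [Module R M'']

/-- The left end of a short exact sequence has grade one more than the right end, if the grade of
the middle term is larger than that of the right end. -/
lemma HasExtGrade.of_exact {d : ℕ} (f : M →ₗ[R] M') (g : M' →ₗ[R] M'')
    (hf : Function.Injective f) (hfg : Function.Exact f g) (hg : Function.Surjective g)
    (h₃ : HasExtGrade R N M'' d)
    (h₂ : ∀ i ≤ d, Subsingleton (Ext (ModuleCat.of R N) (ModuleCat.of R M') i)) :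
    HasExtGrade R N M (d + 1) := by
  let S := ModuleCat.shortComplexOfCompEqZero f g hfg.linearMap_comp_eq_zero
  have hS : S.ShortExact := ModuleCat.shortComplex_shortExact S hfg hf hg
  refine ⟨fun i hi ↦ subsingleton_of_forall_eq 0 fun x ↦ ?_, ?_⟩
  · have := h₂ i (by omega)
    cases i with
    | zero =>
      have := hS.mono_f
      apply Ext.postcomp_mk₀_injective_of_mono (ModuleCat.of R N) S.f
      exact Subsingleton.elim _ _
    | succ j =>
      obtain ⟨y, rfl⟩ := Ext.covariant_sequence_exact₁ _ hS x (Subsingleton.elim _ _) rfl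
      have := h₃.1 j (by omega)
      rw [Subsingleton.elim y 0, Ext.zero_comp]
  · obtain ⟨x, hx⟩ := @exists_ne _ h₃.2 0
    refine nontrivial_of_ne (x.comp hS.extClass rfl) 0 fun h0 ↦ hx ?_
    obtain ⟨y, rfl⟩ := Ext.covariant_sequence_exact₃ _ hS x rfl h0
    have := h₂ d le_rfl
    rw [Subsingleton.elim y 0, Ext.zero_comp]

/-- Dividing `M` by an `M`-regular element `r` that annihilates `N` lowers the grade by one, since
multiplication by `r` is zero on `Ext^i(N, M)`. -/
lemma HasExtGrade.of_exact_smul {d : ℕ} {r : R} (hr : r ∈ Module.annihilator R N)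
    (g : M →ₗ[R] M') (hreg : IsSMulRegular M r) (hg : Function.Surjective g)
    (hker : ∀ x, g x = 0 ↔ ∃ y, r • y = x) (h : HasExtGrade R N M' d) :
    HasExtGrade R N M (d + 1) := by
  have hex : Function.Exact (LinearMap.lsmul R M r) g := fun x ↦ by simpa using hker x
  let S := ModuleCat.shortComplexOfCompEqZero (LinearMap.lsmul R M r) g hex.linearMap_comp_eq_zero
  have hS : S.ShortExact := ModuleCat.shortComplex_shortExact S hex hreg hg
  have hzero (i : ℕ) (x : Ext (ModuleCat.of R N) S.X₁ i) :
      x.comp (Ext.mk₀ S.f) (add_zero i) = 0 :=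
    DFunLike.congr_fun (congrArg AddCommGrpCat.Hom.hom
      (Ext.postcomp_smul_id_eq_zero_of_mem_annihilator (M := ModuleCat.of R M)
        (N := ModuleCat.of R N) hr i)) x
  refine HasExtGrade.of_exact (LinearMap.lsmul R M r) g hreg hex hg h fun i hi ↦
    subsingleton_of_forall_eq 0 fun x ↦ ?_
  cases i with
  | zero =>
    have := hS.mono_f
    apply Ext.postcomp_mk₀_injective_of_mono (ModuleCat.of R N) S.f
    simpa using hzero 0 x
  | succ j =>
    obtain ⟨y, rfl⟩ := Ext.covariant_sequence_exact₁ _ hS x (hzero _ x) rfl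
    have := h.1 j (by omega)
    rw [Subsingleton.elim y 0, Ext.zero_comp]

lemma ext_subsingleton_prod {i : ℕ}
    (h₁ : Subsingleton (Ext (ModuleCat.of R N) (ModuleCat.of R M) i))
    (h₂ : Subsingleton (Ext (ModuleCat.of R N) (ModuleCat.of R M') i)) :
    Subsingleton (Ext (ModuleCat.of R N) (ModuleCat.of R (M × M')) i) := by
  let S := ModuleCat.shortComplexOfCompEqZero (LinearMap.inl R M M') (LinearMap.snd R M M')
    Function.Exact.inl_snd.linearMap_comp_eq_zero
  have hS : S.ShortExact := ModuleCat.shortComplex_shortExact S Function.Exact.inl_snd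
    LinearMap.inl_injective Prod.snd_surjective
  refine subsingleton_of_forall_eq 0 fun x ↦ ?_
  obtain ⟨y, rfl⟩ := Ext.covariant_sequence_exact₂ _ hS x (h₂.elim _ _)
  rw [h₁.elim y 0, Ext.zero_comp]

/-- Mayer–Vietoris: the grade of an intersection is one more than the grade of the sum, if the two
submodules have larger grade than their sum. -/
lemma HasExtGrade.inf {d : ℕ} (A B : Submodule R M)
    (h : HasExtGrade R N ↥(A ⊔ B) d)
    (hA : ∀ i ≤ d, Subsingleton (Ext (ModuleCat.of R N) (ModuleCat.of R A) i))
    (hB : ∀ i ≤ d, Subsingleton (Ext (ModuleCat.of R N) (ModuleCat.of R B) i)) :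
    HasExtGrade R N ↥(A ⊓ B) (d + 1) := by
  let f : ↥(A ⊓ B) →ₗ[R] A × B :=
    (Submodule.inclusion inf_le_left).prod (Submodule.inclusion inf_le_right)
  let g : A × B →ₗ[R] ↥(A ⊔ B) :=
    (Submodule.inclusion le_sup_left).coprod (-Submodule.inclusion le_sup_right)
  refine HasExtGrade.of_exact f g ?_ ?_ ?_ h
    fun i hi ↦ ext_subsingleton_prod (hA i hi) (hB i hi)
  · intro x y hxy
    exact Subtype.ext (congrArg (fun z : A × B ↦ (z.1 : M)) hxy)
  · rintro ⟨⟨a, ha⟩, ⟨b, hb⟩⟩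
    constructor
    · intro h0
      have hab : a = b := by simpa [g, ← sub_eq_add_neg, sub_eq_zero] using congrArg Subtype.val h0
      subst hab
      exact ⟨⟨a, ha, hb⟩, rfl⟩
    · rintro ⟨⟨x, hx⟩, hxy⟩
      have h1 : x = a := congrArg (fun z : A × B ↦ (z.1 : M)) hxy
      have h2 : x = b := congrArg (fun z : A × B ↦ (z.2 : M)) hxy
      subst h1 h2
      apply Subtype.ext
      simp [g]
  · rintro ⟨x, hx⟩
    obtain ⟨a, ha, b, hb, rfl⟩ := Submodule.mem_sup.mp hx
    exact ⟨(⟨a, ha⟩, ⟨-b, B.neg_mem hb⟩), Subtype.ext (by simp [g])⟩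

/-- A nonzero map from `N` to `M` makes the grade zero. For `N` the residue field of a maximal
ideal, such a map amounts to a nonzero socle element of `M`. -/
lemma HasExtGrade.zero_of_linearMap_ne_zero (f : N →ₗ[R] M) (hf : f ≠ 0) :
    HasExtGrade R N M 0 := by
  refine ⟨by simp, ?_⟩
  have : Nontrivial (N →ₗ[R] M) := nontrivial_of_ne f 0 hf
  exact (Ext.addEquiv₀.trans ModuleCat.homAddEquiv).toEquiv.nontrivial

lemma HasExtGrade.congr {d : ℕ} (e : M ≃ₗ[R] M')
    (h : HasExtGrade R N M d) : HasExtGrade R N M' d := by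
  have e' : ∀ i, Ext (ModuleCat.of R N) (ModuleCat.of R M) i ≃
      Ext (ModuleCat.of R N) (ModuleCat.of R M') i := fun i ↦
    (((extFunctorObj (ModuleCat.of R N) i).mapIso e.toModuleIso).addCommGroupIsoToAddEquiv).toEquiv
  exact ⟨fun i hi ↦ (e' i).subsingleton_congr.mp (h.1 i hi), (e' d).nontrivial_congr.mp h.2⟩

end ExtGrade

end MonomialDepth

/-! ### Depth of modules over the polynomial ring -/

namespace MonomialDepth

section Depth

open CategoryTheory Abelian MvPolynomial

universe u

variable {K : Type u} [Field K] {n : ℕ}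

/-- By Rees' theorem, the depth is the grade of the residue field of `(x_1, …, x_n)`. -/
lemma HasExtGrade.depth_eq (M : Type u) [AddCommGroup M] [Module (MvPolynomial (Fin n) K) M]
    [Module.Finite (MvPolynomial (Fin n) K) M] {d : ℕ}
    (hM : idealOfVars (Fin n) K • (⊤ : Submodule (MvPolynomial (Fin n) K) M) < ⊤)
    (h : HasExtGrade (MvPolynomial (Fin n) K)
      (MvPolynomial (Fin n) K ⧸ idealOfVars (Fin n) K) M d) :
    depth (K := K) (n := n) M = d := by
  have hsupp : Module.support (MvPolynomial (Fin n) K)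
      (MvPolynomial (Fin n) K ⧸ idealOfVars (Fin n) K) =
      PrimeSpectrum.zeroLocus (idealOfVars (Fin n) K) := by
    rw [Module.support_eq_zeroLocus, Ideal.annihilator_quotient]
  apply le_antisymm
  · refine iSup₂_le fun rs ⟨hrs, hreg⟩ ↦ ?_
    by_contra! hlt
    have := ModuleCat.subsingleton_ext_of_exists_isRegular (idealOfVars (Fin n) K)
      (ModuleCat.of (MvPolynomial (Fin n) K) (MvPolynomial (Fin n) K ⧸ idealOfVars (Fin n) K))
      hsupp.subset (ModuleCat.of (MvPolynomial (Fin n) K) M) hM rs hrs hreg d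
      (by exact_mod_cast hlt)
    exact not_subsingleton_iff_nontrivial.mpr h.2 this
  · obtain ⟨rs, hlen, hmem, hreg⟩ := ModuleCat.exists_isRegular_of_exists_subsingleton_ext
      (idealOfVars (Fin n) K) d (ModuleCat.of (MvPolynomial (Fin n) K) M) hM
      (ModuleCat.of (MvPolynomial (Fin n) K) (MvPolynomial (Fin n) K ⧸ idealOfVars (Fin n) K))
      hsupp h.1
    rw [← hlen]
    exact le_iSup₂_of_le rs ⟨hmem, hreg⟩ le_rfl

lemma idealOfVars_ne_top : idealOfVars (Fin n) K ≠ ⊤ := by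
  intro h
  have h1 : (1 : MvPolynomial (Fin n) K) ∈ idealOfVars (Fin n) K := h ▸ Submodule.mem_top
  have h2 := (C_mem_pow_idealOfVars_iff (σ := Fin n) (R := K) 1 1).mp (by simpa using h1)
  simp at h2

/-- Nakayama's lemma for a nonzero ideal of the polynomial ring: no localization is needed, because
ideals are torsion-free. -/
lemma idealOfVars_smul_top_lt_top {I : Ideal (MvPolynomial (Fin n) K)} (hI : I ≠ ⊥) :
    idealOfVars (Fin n) K • (⊤ : Submodule (MvPolynomial (Fin n) K) I) < ⊤ := by
  refine lt_top_iff_ne_top.mpr fun h ↦ ?_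
  obtain ⟨r, hr, hr0⟩ := Submodule.exists_sub_one_mem_and_smul_eq_zero_of_fg_of_le_smul
    (idealOfVars (Fin n) K) (⊤ : Submodule (MvPolynomial (Fin n) K) I)
    (IsNoetherian.noetherian _) h.ge
  obtain ⟨x, hx, hx0⟩ := Submodule.exists_mem_ne_zero_of_ne_bot hI
  have hrx : r * x = 0 := congrArg Subtype.val (hr0 ⟨x, hx⟩ trivial)
  obtain rfl : r = 0 := (mul_eq_zero.mp hrx).resolve_right hx0
  refine idealOfVars_ne_top (K := K) (n := n) ((Ideal.eq_top_iff_one _).mpr ?_)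
  simpa using neg_mem hr

end Depth

end MonomialDepth

/-! ### Monomial ideals -/

namespace MonomialDepth

section Monomial

open MvPolynomial

variable {K : Type*} [Field K] {n : ℕ}

/-- Membership in a monomial ideal is tested term by term. -/
lemma IsMonomialIdeal.mem_iff {I : Ideal (MvPolynomial (Fin n) K)} (hI : IsMonomialIdeal I)
    {f : MvPolynomial (Fin n) K} : f ∈ I ↔ ∀ a ∈ f.support, monomial a (1 : K) ∈ I := by
  obtain ⟨A, rfl⟩ := hI
  simp [mem_ideal_span_monomial_image]

lemma isMonomialIdeal_of_forall_mem {I : Ideal (MvPolynomial (Fin n) K)}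
    (h : ∀ f ∈ I, ∀ a ∈ f.support, monomial a (1 : K) ∈ I) : IsMonomialIdeal I := by
  refine ⟨{a | monomial a (1 : K) ∈ I}, le_antisymm (fun f hf ↦ ?_) ?_⟩
  · exact mem_ideal_span_monomial_image.mpr fun a ha ↦ ⟨a, h f hf a ha, le_rfl⟩
  · rw [Ideal.span_le]
    rintro _ ⟨a, ha, rfl⟩
    exact ha

lemma IsMonomialIdeal.le_of_forall {I J : Ideal (MvPolynomial (Fin n) K)} (hI : IsMonomialIdeal I)
    (hJ : IsMonomialIdeal J) (h : ∀ a, monomial a (1 : K) ∈ I → monomial a (1 : K) ∈ J) :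
    I ≤ J := fun _ hf ↦ hJ.mem_iff.mpr fun a ha ↦ h a (hI.mem_iff.mp hf a ha)

lemma IsMonomialIdeal.sup {I J : Ideal (MvPolynomial (Fin n) K)} (hI : IsMonomialIdeal I)
    (hJ : IsMonomialIdeal J) : IsMonomialIdeal (I ⊔ J) := by
  obtain ⟨A, rfl⟩ := hI
  obtain ⟨B, rfl⟩ := hJ
  exact ⟨A ∪ B, by rw [Set.image_union, Ideal.span_union]⟩

lemma IsMonomialIdeal.monomial_mem_sup_iff {I J : Ideal (MvPolynomial (Fin n) K)}
    (hI : IsMonomialIdeal I) (hJ : IsMonomialIdeal J) {a : Fin n →₀ ℕ} :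
    monomial a (1 : K) ∈ I ⊔ J ↔ monomial a (1 : K) ∈ I ∨ monomial a (1 : K) ∈ J := by
  obtain ⟨A, rfl⟩ := hI
  obtain ⟨B, rfl⟩ := hJ
  rw [← Ideal.span_union, ← Set.image_union]
  simp [mem_ideal_span_monomial_image, or_and_right, exists_or]

lemma isMonomialIdeal_finset_inf {ι : Type*} (T : Finset ι)
    (Q : ι → Ideal (MvPolynomial (Fin n) K)) (h : ∀ i ∈ T, IsMonomialIdeal (Q i)) :
    IsMonomialIdeal (T.inf Q) := by
  refine isMonomialIdeal_of_forall_mem fun f hf a ha ↦ ?_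
  rw [Submodule.mem_finsetInf] at hf ⊢
  exact fun i hi ↦ (h i hi).mem_iff.mp (hf i hi) a ha

lemma isMonomialIdeal_span_X_image (F : Set (Fin n)) :
    IsMonomialIdeal (Ideal.span (X '' F : Set (MvPolynomial (Fin n) K))) :=
  ⟨(fun j ↦ Finsupp.single j 1) '' F, by rw [Set.image_image]; rfl⟩

lemma monomial_mem_span_X_image_iff {F : Set (Fin n)} {a : Fin n →₀ ℕ} :
    monomial a (1 : K) ∈ Ideal.span (X '' F : Set (MvPolynomial (Fin n) K)) ↔
      ∃ j ∈ F, a j ≠ 0 := by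
  rw [mem_ideal_span_X_image]
  simp

/-- Sums distribute over intersections of monomial ideals. -/
lemma finset_inf_sup_of_isMonomialIdeal {ι : Type*} (T : Finset ι)
    (Q : ι → Ideal (MvPolynomial (Fin n) K)) (h : ∀ i ∈ T, IsMonomialIdeal (Q i))
    {J : Ideal (MvPolynomial (Fin n) K)} (hJ : IsMonomialIdeal J) :
    T.inf Q ⊔ J = T.inf fun i ↦ Q i ⊔ J := by
  have hQ := isMonomialIdeal_finset_inf T Q h
  refine le_antisymm (Finset.le_inf fun i hi ↦ sup_le_sup_right (Finset.inf_le hi) J) ?_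
  refine (isMonomialIdeal_finset_inf T _ fun i hi ↦ (h i hi).sup hJ).le_of_forall (hQ.sup hJ)
    fun a ha ↦ ?_
  rw [Submodule.mem_finsetInf] at ha
  rw [hQ.monomial_mem_sup_iff hJ, Submodule.mem_finsetInf]
  by_cases haJ : monomial a (1 : K) ∈ J
  · exact Or.inr haJ
  · exact Or.inl fun i hi ↦ (((h i hi).monomial_mem_sup_iff hJ).mp (ha i hi)).resolve_right haJ

/-- A monomial ideal that is primary to the prime `(x_j : j ∈ F)`, expressed through monomials: the
variables in `F` are nilpotent modulo `Q`, the others are nonzerodivisors modulo `Q`. -/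
structure IsVarPrimary (Q : Ideal (MvPolynomial (Fin n) K)) (F : Finset (Fin n)) : Prop where
  isMonomial : IsMonomialIdeal Q
  ne_top : Q ≠ ⊤
  pow_mem : ∀ j ∈ F, ∃ k : ℕ, (X j : MvPolynomial (Fin n) K) ^ k ∈ Q
  mem_of_add_single : ∀ j ∉ F, ∀ a : Fin n →₀ ℕ,
    monomial (a + Finsupp.single j 1) (1 : K) ∈ Q → monomial a (1 : K) ∈ Q

lemma ne_top_iff_monomial_zero_notMem {Q : Ideal (MvPolynomial (Fin n) K)} :
    Q ≠ ⊤ ↔ monomial 0 (1 : K) ∉ Q := by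
  rw [Ne, Ideal.eq_top_iff_one]
  rfl

lemma isVarPrimary_span_X_image (F : Finset (Fin n)) :
    IsVarPrimary (Ideal.span (X '' (F : Set (Fin n)) : Set (MvPolynomial (Fin n) K))) F where
  isMonomial := isMonomialIdeal_span_X_image _
  ne_top := by
    rw [ne_top_iff_monomial_zero_notMem, monomial_mem_span_X_image_iff]
    simp
  pow_mem j hj := ⟨1, by simpa using Ideal.subset_span (Set.mem_image_of_mem X hj)⟩
  mem_of_add_single j hj a ha := by
    rw [monomial_mem_span_X_image_iff] at ha ⊢
    obtain ⟨i, hi, h0⟩ := ha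
    refine ⟨i, hi, ?_⟩
    have : j ≠ i := fun h ↦ hj (h ▸ hi)
    simpa [Finsupp.single_apply, this] using h0

lemma IsVarPrimary.sup {Q Q' : Ideal (MvPolynomial (Fin n) K)} {F F' : Finset (Fin n)}
    (h : IsVarPrimary Q F) (h' : IsVarPrimary Q' F') : IsVarPrimary (Q ⊔ Q') (F ∪ F') where
  isMonomial := h.isMonomial.sup h'.isMonomial
  ne_top := by
    rw [ne_top_iff_monomial_zero_notMem, h.isMonomial.monomial_mem_sup_iff h'.isMonomial, not_or]
    exact ⟨ne_top_iff_monomial_zero_notMem.mp h.ne_top,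
      ne_top_iff_monomial_zero_notMem.mp h'.ne_top⟩
  pow_mem j hj := by
    rcases Finset.mem_union.mp hj with hj | hj
    · exact (h.pow_mem j hj).imp fun _ hk ↦ Ideal.mem_sup_left hk
    · exact (h'.pow_mem j hj).imp fun _ hk ↦ Ideal.mem_sup_right hk
  mem_of_add_single j hj a ha := by
    rw [Finset.mem_union, not_or] at hj
    rw [h.isMonomial.monomial_mem_sup_iff h'.isMonomial] at ha ⊢
    exact ha.imp (h.mem_of_add_single j hj.1 a) (h'.mem_of_add_single j hj.2 a)

lemma IsVarPrimary.isSMulRegular {Q : Ideal (MvPolynomial (Fin n) K)} {F : Finset (Fin n)}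
    (h : IsVarPrimary Q F) {j : Fin n} (hj : j ∉ F) :
    IsSMulRegular (MvPolynomial (Fin n) K ⧸ Q) (X j : MvPolynomial (Fin n) K) := by
  refine (isSMulRegular_quotient_iff_mem_of_smul_mem Q _).mpr fun f hf ↦ ?_
  refine h.isMonomial.mem_iff.mpr fun a ha ↦ h.mem_of_add_single j hj a ?_
  refine h.isMonomial.mem_iff.mp hf _ ?_
  rw [smul_eq_mul, mul_comm, mem_support_iff, coeff_mul_X]
  exact mem_support_iff.mp ha

end Monomial

/-! ### Grade of intersections of primary monomial ideals -/

section Grade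

open CategoryTheory Abelian MvPolynomial

universe u

variable {K : Type u} [Field K] {n : ℕ}

/-- The ideal `(x_1, …, x_n)` is maximal. -/
lemma le_idealOfVars_of_ne_top {p : Ideal (MvPolynomial (Fin n) K)} (hp : p ≠ ⊤)
    (h : idealOfVars (Fin n) K ≤ p) : p ≤ idealOfVars (Fin n) K := by
  intro f hf
  have hsub : f - C (constantCoeff f) ∈ idealOfVars (Fin n) K := by
    rw [← pow_one (idealOfVars (Fin n) K), mem_pow_idealOfVars_iff']
    intro a ha
    obtain rfl : a = 0 := (Finsupp.degree_eq_zero_iff a).mp (Nat.lt_one_iff.mp ha)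
    simp [constantCoeff_eq]
  by_cases h0 : constantCoeff f = 0
  · simpa [h0] using hsub
  · refine absurd (p.eq_top_of_isUnit_mem ?_ ((IsUnit.mk0 _ h0).map C)) hp
    simpa using p.sub_mem hf (h hsub)

/-- `S/Q` is Cohen–Macaulay: the variables outside `F` form a regular sequence, and what is left
is a module of finite length, which has a socle. -/
lemma IsVarPrimary.hasExtGrade_quotient {Q : Ideal (MvPolynomial (Fin n) K)} {F : Finset (Fin n)}
    (h : IsVarPrimary Q F) {d : ℕ} (hd : F.card + d = n) :
    HasExtGrade (MvPolynomial (Fin n) K)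
      (MvPolynomial (Fin n) K ⧸ idealOfVars (Fin n) K) (MvPolynomial (Fin n) K ⧸ Q) d := by
  classical
  induction d generalizing Q F with
  | zero =>
    obtain rfl : F = Finset.univ := Finset.eq_univ_of_card F (by simpa using hd)
    have := Ideal.Quotient.nontrivial_iff.mpr h.ne_top
    obtain ⟨p, hp⟩ := associatedPrimes.nonempty (MvPolynomial (Fin n) K)
      (MvPolynomial (Fin n) K ⧸ Q)
    obtain ⟨hprime, f, hf⟩ := (isAssociatedPrime_iff_exists_injective_linearMap _ _).mp hp
    have hQp : Q ≤ p := by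
      have := IsAssociatedPrime.annihilator_le hp
      rwa [Submodule.annihilator_top, Ideal.annihilator_quotient] at this
    have hle : idealOfVars (Fin n) K ≤ p := by
      rw [Ideal.span_le]
      rintro _ ⟨j, rfl⟩
      obtain ⟨k, hk⟩ := h.pow_mem j (Finset.mem_univ j)
      exact hprime.mem_of_pow_mem k (hQp hk)
    -- `𝔪` is the only possible associated prime, which gives an embedding of `S/𝔪` into `S/Q`
    obtain rfl := le_antisymm hle (le_idealOfVars_of_ne_top hprime.ne_top hle)
    have := Ideal.Quotient.nontrivial_iff.mpr hprime.ne_top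
    refine HasExtGrade.zero_of_linearMap_ne_zero f ?_
    rintro rfl
    obtain ⟨x, hx⟩ := exists_ne (0 : MvPolynomial (Fin n) K ⧸ idealOfVars (Fin n) K)
    exact hx (hf rfl)
  | succ d ih =>
    obtain ⟨j, -, hj⟩ := Finset.exists_mem_notMem_of_card_lt_card (s := F) (t := Finset.univ)
      (by simp; omega)
    have h' := h.sup (isVarPrimary_span_X_image {j})
    rw [Finset.coe_singleton, Set.image_singleton] at h'
    have hcard : (F ∪ {j}).card = F.card + 1 := by
      rw [Finset.card_union_of_disjoint (by simpa using hj), Finset.card_singleton]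
    refine HasExtGrade.of_exact_smul (r := X j) ?_
      (Ideal.Quotient.factorₐ (MvPolynomial (Fin n) K) (le_sup_left : Q ≤ Q ⊔ Ideal.span {X j})
        ).toLinearMap (h.isSMulRegular hj) ?_ ?_ (ih h' (by omega))
    · rw [Ideal.annihilator_quotient]
      exact Ideal.subset_span ⟨j, rfl⟩
    · exact Ideal.Quotient.factor_surjective le_sup_left
    · intro x
      obtain ⟨f, rfl⟩ := Ideal.Quotient.mk_surjective x
      change Ideal.Quotient.mk _ f = 0 ↔ _
      rw [Ideal.Quotient.eq_zero_iff_mem, Submodule.mem_sup]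
      constructor
      · rintro ⟨q, hq, z, hz, rfl⟩
        obtain ⟨g, rfl⟩ := Ideal.mem_span_singleton'.mp hz
        refine ⟨Ideal.Quotient.mk Q g, ?_⟩
        rw [map_add, Ideal.Quotient.eq_zero_iff_mem.mpr hq, zero_add, mul_comm]
        rfl
      · rintro ⟨y, hy⟩
        obtain ⟨g, rfl⟩ := Ideal.Quotient.mk_surjective y
        refine ⟨f - X j * g, ?_, X j * g,
          Ideal.mul_mem_right _ _ (Ideal.subset_span rfl), sub_add_cancel _ _⟩
        rw [← Ideal.Quotient.eq_zero_iff_mem, map_sub, ← hy]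
        exact sub_eq_zero.mpr rfl

lemma hasExtGrade_self :
    HasExtGrade (MvPolynomial (Fin n) K)
      (MvPolynomial (Fin n) K ⧸ idealOfVars (Fin n) K) (MvPolynomial (Fin n) K) n := by
  have h := (isVarPrimary_span_X_image (K := K) (n := n) ∅).hasExtGrade_quotient (d := n) (by simp)
  refine h.congr (Submodule.quotEquivOfEqBot _ ?_)
  simp

lemma IsVarPrimary.hasExtGrade {Q : Ideal (MvPolynomial (Fin n) K)} {F : Finset (Fin n)}
    (h : IsVarPrimary Q F) (hF : F.Nonempty) {d : ℕ} (hd : F.card + d = n) :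
    HasExtGrade (MvPolynomial (Fin n) K)
      (MvPolynomial (Fin n) K ⧸ idealOfVars (Fin n) K) Q (d + 1) := by
  have := hF.card_pos
  exact HasExtGrade.of_exact Q.subtype Q.mkQ Q.injective_subtype
    (LinearMap.exact_subtype_mkQ Q) Q.mkQ_surjective (h.hasExtGrade_quotient hd)
    fun i hi ↦ hasExtGrade_self.1 i (by omega)

/-- The grade of an intersection of ideals primary to primes `(x_j : j ∈ F_i)`, each `F_i`
containing an element outside the others. Splitting off one component `Q`, the sum of `Q` and of
the intersection `J` of the others is again such an intersection, with one component less and the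
same union of the `F_i`; its grade is smaller than those of `J` and `Q`. -/
lemma hasExtGrade_finset_inf {ι : Type*} [DecidableEq ι] (T : Finset ι) (hT : T.Nonempty)
    (Q : ι → Ideal (MvPolynomial (Fin n) K)) (F : ι → Finset (Fin n))
    (hQ : ∀ i ∈ T, IsVarPrimary (Q i) (F i))
    (hF : ∀ i ∈ T, ∃ y ∈ F i, ∀ j ∈ T, j ≠ i → y ∉ F j)
    {d : ℕ} (hd : (T.biUnion F).card + d = T.card + n) :
    HasExtGrade (MvPolynomial (Fin n) K)
      (MvPolynomial (Fin n) K ⧸ idealOfVars (Fin n) K) ↥(T.inf Q) d := by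
  induction hT using Finset.Nonempty.cons_induction generalizing Q F d with
  | singleton i =>
    obtain ⟨y, hy, -⟩ := hF i (by simp)
    rw [Finset.inf_singleton]
    rw [Finset.singleton_biUnion, Finset.card_singleton] at hd
    have := Finset.card_le_univ (F i)
    rw [Fintype.card_fin] at this
    obtain ⟨d, rfl⟩ : ∃ e, d = e + 1 := ⟨d - 1, by omega⟩
    exact (hQ i (by simp)).hasExtGrade ⟨y, hy⟩ (by omega)
  | cons i T hi hT ih =>
    rw [Finset.cons_eq_insert] at *
    rw [Finset.card_insert_of_notMem hi, Finset.biUnion_insert] at hd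
    obtain ⟨y, hy, hy'⟩ := hF i (by simp)
    -- the grade of the intersection of the other components is larger than that of the sum, since
    -- `y` is lost from the union of the `F j`
    have hyT : y ∉ T.biUnion F := by
      simp only [Finset.mem_biUnion, not_exists, not_and]
      exact fun j hj ↦ hy' j (by simp [hj]) fun h ↦ hi (h ▸ hj)
    -- the grade of `Q i` is larger than that of the sum, since each of the others contributes an
    -- element to the union of the `F j`
    have hTn : T.card ≤ (T.biUnion F \ F i).card := by
      have hF' : ∀ j ∈ T, ∃ z ∈ F j, ∀ k ∈ insert i T, k ≠ j → z ∉ F k := fun j hj ↦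
        hF j (by simp [hj])
      have : Nonempty (Fin n) := ⟨y⟩
      choose! z hz hz' using hF'
      refine Finset.card_le_card_of_injOn z (fun j hj ↦ ?_) fun j hj k hk hjk ↦ ?_
      · simp only [Finset.coe_sdiff, Set.mem_sdiff, Finset.mem_coe, Finset.mem_biUnion]
        exact ⟨⟨j, hj, hz j hj⟩, hz' j hj i (by simp) fun h ↦ hi (h ▸ hj)⟩
      · by_contra hne
        exact hz' k hk j (by simp [Finset.mem_coe.mp hj]) hne (hjk ▸ hz j hj)
    have hunion := Finset.card_sdiff_add_card (T.biUnion F) (F i)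
    rw [Finset.union_comm] at hunion
    have hlt : (T.biUnion F).card < (F i ∪ T.biUnion F).card :=
      Finset.card_lt_card ⟨Finset.subset_union_right, fun h ↦ hyT (h (by simp [hy]))⟩
    have hn := Finset.card_le_univ (F i ∪ T.biUnion F)
    rw [Fintype.card_fin] at hn
    obtain ⟨d, rfl⟩ : ∃ e, d = e + 1 := ⟨d - 1, by omega⟩
    rw [Finset.inf_insert, inf_comm]
    apply HasExtGrade.inf
    · rw [finset_inf_sup_of_isMonomialIdeal T Q (fun j hj ↦ (hQ j (by simp [hj])).isMonomial)
        (hQ i (by simp)).isMonomial]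
      refine ih _ (fun j ↦ F j ∪ F i)
        (fun j hj ↦ (hQ j (by simp [hj])).sup (hQ i (by simp))) (fun j hj ↦ ?_) ?_
      · obtain ⟨z, hz, hz'⟩ := hF j (by simp [hj])
        refine ⟨z, by simp [hz], fun k hk hkj ↦ ?_⟩
        rw [Finset.mem_union, not_or]
        exact ⟨hz' k (by simp [hk]) hkj, hz' i (by simp) fun h ↦ hi (h ▸ hj)⟩
      · have : T.biUnion (fun j ↦ F j ∪ F i) = F i ∪ T.biUnion F := by
          ext x
          obtain ⟨j, hj⟩ := hT
          simp only [Finset.mem_biUnion, Finset.mem_union]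
          grind
        rw [this]
        omega
    · have := ih Q F (fun j hj ↦ hQ j (by simp [hj])) (fun j hj ↦ ?_)
        (d := T.card + n - (T.biUnion F).card) (by omega)
      · exact fun k hk ↦ this.1 k (by omega)
      · obtain ⟨z, hz, hz'⟩ := hF j (by simp [hj])
        exact ⟨z, hz, fun k hk ↦ hz' k (by simp [hk])⟩
    · have := (hQ i (by simp)).hasExtGrade ⟨y, hy⟩ (d := n - (F i).card)
        (by have := Finset.card_le_univ (F i); rw [Fintype.card_fin] at this; omega)
      exact fun k hk ↦ this.1 k (by omega)

end Grade

end MonomialDepth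

/-! ### Primary monomial ideals -/

namespace MonomialDepth

section Primary

open MvPolynomial

variable {K : Type*} [Field K] {n : ℕ}

/-- The terms of a polynomial whose exponents satisfy `p` can be split off. -/
lemma exists_add_eq_and_support (p : (Fin n →₀ ℕ) → Prop) (f : MvPolynomial (Fin n) K) :
    ∃ g h : MvPolynomial (Fin n) K, g + h = f ∧ (∀ a ∈ g.support, p a) ∧
      ∀ a ∈ h.support, a ∈ f.support ∧ ¬ p a := by
  classical
  have hcoeff (s : Finset (Fin n →₀ ℕ)) (m : Fin n →₀ ℕ) :
      coeff m (∑ a ∈ s, monomial a (coeff a f)) = if m ∈ s then coeff m f else 0 := by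
    simp [coeff_sum, coeff_monomial]
  refine ⟨∑ a ∈ f.support.filter p, monomial a (coeff a f),
    ∑ a ∈ f.support.filter (¬ p ·), monomial a (coeff a f), ?_, fun a ha ↦ ?_, fun a ha ↦ ?_⟩
  · rw [Finset.sum_filter_add_sum_filter_not]
    exact support_sum_monomial_coeff f
  all_goals
    rw [mem_support_iff, hcoeff] at ha
    have ha' := (ite_ne_right_iff.mp ha).1
    rw [Finset.mem_filter] at ha'
  · exact ha'.2
  · exact ha'

lemma IsVarPrimary.mem_of_add {Q : Ideal (MvPolynomial (Fin n) K)} {F : Finset (Fin n)}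
    (h : IsVarPrimary Q F) (b : Fin n →₀ ℕ) (hb : ∀ j ∈ F, b j = 0) (a : Fin n →₀ ℕ)
    (hab : monomial (a + b) (1 : K) ∈ Q) : monomial a (1 : K) ∈ Q := by
  induction b using Finsupp.induction_linear generalizing a with
  | zero => simpa using hab
  | add b c ihb ihc =>
    have hbc : ∀ j ∈ F, b j = 0 ∧ c j = 0 := fun j hj ↦ by simpa using hb j hj
    exact ihb (fun j hj ↦ (hbc j hj).1) a
      (ihc (fun j hj ↦ (hbc j hj).2) (a + b) (by rwa [add_assoc]))
  | single j k =>
    induction k with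
    | zero => simpa using hab
    | succ k ih =>
      have hj : j ∉ F := fun hj ↦ by simpa using hb j hj
      refine ih (fun i hi ↦ Finsupp.single_eq_of_ne fun hij ↦ hj (hij ▸ hi)) ?_
      refine h.mem_of_add_single j hj _ ?_
      rwa [add_assoc, ← Finsupp.single_add]

/-- A polynomial in the variables outside `F` is a nonzerodivisor modulo `Q`, as one sees from the
leading terms. -/
lemma IsVarPrimary.mem_of_mul_mem_of_supported {Q : Ideal (MvPolynomial (Fin n) K)}
    {F : Finset (Fin n)} (h : IsVarPrimary Q F) {f g : MvPolynomial (Fin n) K} (hg : g ≠ 0)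
    (hgF : g ∈ supported K ((F : Set (Fin n))ᶜ)) (hfg : f * g ∈ Q) : f ∈ Q := by
  obtain ⟨f₁, f₂, rfl, hf₁, hf₂⟩ := exists_add_eq_and_support (monomial · (1 : K) ∈ Q) f
  have hf₁Q : f₁ ∈ Q := h.isMonomial.mem_iff.mpr hf₁
  suffices f₂ = 0 by simpa [this] using hf₁Q
  by_contra h0
  have hmem : f₂ * g ∈ Q := by
    have := Q.sub_mem hfg (Q.mul_mem_right g hf₁Q)
    rwa [add_mul, add_sub_cancel_left] at this
  let m : MonomialOrder (Fin n) := MonomialOrder.lex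
  have hdeg := h.isMonomial.mem_iff.mp hmem _
    (m.degree_mem_support (mul_ne_zero h0 hg))
  rw [MonomialOrder.degree_mul h0 hg] at hdeg
  refine (hf₂ _ (m.degree_mem_support h0)).2 (h.mem_of_add (m.degree g) (fun j hj ↦ ?_) _ hdeg)
  by_contra hj0
  exact mem_supported.mp hgF (mem_vars_iff_mem_support j |>.mpr
    ⟨_, m.degree_mem_support hg, Finsupp.mem_support_iff.mpr hj0⟩) hj

lemma IsVarPrimary.span_X_image_le_radical {Q : Ideal (MvPolynomial (Fin n) K)}
    {F : Finset (Fin n)} (h : IsVarPrimary Q F) :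
    Ideal.span (X '' (F : Set (Fin n)) : Set (MvPolynomial (Fin n) K)) ≤ Q.radical := by
  rw [Ideal.span_le]
  rintro _ ⟨j, hj, rfl⟩
  exact h.pow_mem j hj

lemma IsVarPrimary.mem_of_mul_mem {Q : Ideal (MvPolynomial (Fin n) K)}
    {F : Finset (Fin n)} (h : IsVarPrimary Q F) {f g : MvPolynomial (Fin n) K}
    (hg : g ∉ Ideal.span (X '' (F : Set (Fin n)) : Set (MvPolynomial (Fin n) K)))
    (hfg : f * g ∈ Q) : f ∈ Q := by
  obtain ⟨g₁, g₂, rfl, hg₁, hg₂⟩ := exists_add_eq_and_support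
    (monomial · (1 : K) ∈ Ideal.span (X '' (F : Set (Fin n)) : Set (MvPolynomial (Fin n) K))) g
  have hg₁F := (isMonomialIdeal_span_X_image (K := K) (F : Set (Fin n))).mem_iff.mpr hg₁
  have hg0 : g₂ ≠ 0 := by
    rintro rfl
    exact hg (by simpa using hg₁F)
  have hg₂F : g₂ ∈ supported K ((F : Set (Fin n))ᶜ) := by
    refine mem_supported.mpr fun j hj hjF ↦ ?_
    obtain ⟨a, ha, haj⟩ := (mem_vars_iff_mem_support j).mp hj
    exact (hg₂ a ha).2
      (monomial_mem_span_X_image_iff.mpr ⟨j, hjF, Finsupp.mem_support_iff.mp haj⟩)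
  -- `g₁` is nilpotent modulo `Q`, so some power of `g₂` multiplies `f` into `Q`
  obtain ⟨k, hk⟩ := h.span_X_image_le_radical hg₁F
  refine h.mem_of_mul_mem_of_supported (pow_ne_zero k hg0) (Subalgebra.pow_mem _ hg₂F k) ?_
  have hdvd : g₁ + g₂ ∣ g₂ ^ k - (-g₁) ^ k := by
    simpa [add_comm] using sub_dvd_pow_sub_pow g₂ (-g₁) k
  have h1 := Q.mem_of_dvd (mul_dvd_mul_left f hdvd) hfg
  have h2 : f * (-g₁) ^ k ∈ Q := by
    rw [neg_pow]
    exact Q.mul_mem_left _ (Q.mul_mem_left _ hk)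
  simpa [mul_sub] using Q.add_mem h1 h2

lemma isPrime_span_X_image (F : Finset (Fin n)) :
    (Ideal.span (X '' (F : Set (Fin n)) : Set (MvPolynomial (Fin n) K))).IsPrime := by
  have h := isVarPrimary_span_X_image (K := K) F
  exact ⟨h.ne_top, fun hfg ↦ or_iff_not_imp_right.mpr fun hg ↦ h.mem_of_mul_mem hg hfg⟩

lemma IsVarPrimary.isPrimary {Q : Ideal (MvPolynomial (Fin n) K)} {F : Finset (Fin n)}
    (h : IsVarPrimary Q F) : Q.IsPrimary :=
  Ideal.isPrimary_iff.mpr ⟨h.ne_top, fun hfg ↦ or_iff_not_imp_right.mpr fun hg ↦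
    h.mem_of_mul_mem (fun h' ↦ hg (h.span_X_image_le_radical h')) hfg⟩

lemma IsVarPrimary.radical_eq {Q : Ideal (MvPolynomial (Fin n) K)} {F : Finset (Fin n)}
    (h : IsVarPrimary Q F) :
    Q.radical = Ideal.span (X '' (F : Set (Fin n)) : Set (MvPolynomial (Fin n) K)) := by
  refine le_antisymm ?_ h.span_X_image_le_radical
  rw [(isPrime_span_X_image F).radical_le_iff]
  intro f hf
  by_contra hfF
  refine h.ne_top ((Ideal.eq_top_iff_one _).mpr (h.mem_of_mul_mem hfF ?_))
  rwa [one_mul]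

lemma X_mem_span_X_image_iff {F : Set (Fin n)} {j : Fin n} :
    (X j : MvPolynomial (Fin n) K) ∈ Ideal.span (X '' F : Set (MvPolynomial (Fin n) K)) ↔
      j ∈ F := by
  rw [X, monomial_mem_span_X_image_iff]
  simp [Finsupp.single_apply]

open Classical in
/-- The variables that lie in an ideal, as a set of indices. -/
noncomputable def varsIn (P : Ideal (MvPolynomial (Fin n) K)) : Finset (Fin n) :=
  Finset.univ.filter fun j ↦ X j ∈ P

lemma mem_varsIn {P : Ideal (MvPolynomial (Fin n) K)} {j : Fin n} : j ∈ varsIn P ↔ X j ∈ P := by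
  simp [varsIn]

lemma varsIn_span_X_image (F : Finset (Fin n)) :
    varsIn (Ideal.span (X '' (F : Set (Fin n)) : Set (MvPolynomial (Fin n) K))) = F := by
  ext j
  rw [mem_varsIn, X_mem_span_X_image_iff, Finset.mem_coe]

/-- The largest monomial ideal contained in an ideal. -/
noncomputable def monomialCore (Q : Ideal (MvPolynomial (Fin n) K)) :
    Ideal (MvPolynomial (Fin n) K) :=
  Ideal.span ((fun a => monomial a (1 : K)) '' {a | monomial a (1 : K) ∈ Q})

lemma isMonomialIdeal_monomialCore (Q : Ideal (MvPolynomial (Fin n) K)) :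
    IsMonomialIdeal (monomialCore Q) := ⟨_, rfl⟩

lemma monomialCore_le (Q : Ideal (MvPolynomial (Fin n) K)) : monomialCore Q ≤ Q := by
  rw [monomialCore, Ideal.span_le]
  rintro _ ⟨a, ha, rfl⟩
  exact ha

lemma monomial_mem_monomialCore_iff {Q : Ideal (MvPolynomial (Fin n) K)} {a : Fin n →₀ ℕ} :
    monomial a (1 : K) ∈ monomialCore Q ↔ monomial a (1 : K) ∈ Q :=
  ⟨fun h ↦ monomialCore_le Q h, fun h ↦ Ideal.subset_span ⟨a, h, rfl⟩⟩

lemma IsMonomialIdeal.monomialCore_eq {Q : Ideal (MvPolynomial (Fin n) K)}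
    (h : IsMonomialIdeal Q) : monomialCore Q = Q :=
  le_antisymm (monomialCore_le Q)
    (h.le_of_forall (isMonomialIdeal_monomialCore Q) fun _ ↦ monomial_mem_monomialCore_iff.mpr)

/-- The monomial core of a primary ideal is primary. -/
lemma isVarPrimary_monomialCore {Q : Ideal (MvPolynomial (Fin n) K)} (hQ : Q.IsPrimary) :
    IsVarPrimary (monomialCore Q) (varsIn Q.radical) where
  isMonomial := isMonomialIdeal_monomialCore Q
  ne_top h := hQ.ne_top (top_le_iff.mp (h ▸ monomialCore_le Q))
  pow_mem j hj := by
    obtain ⟨k, hk⟩ := mem_varsIn.mp hj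
    refine ⟨k, ?_⟩
    rw [X_pow_eq_monomial] at hk ⊢
    exact monomial_mem_monomialCore_iff.mpr hk
  mem_of_add_single j hj a ha := by
    rw [monomial_mem_monomialCore_iff, monomial_add_single, pow_one] at ha
    exact monomial_mem_monomialCore_iff.mpr
      (((Ideal.isPrimary_iff.mp hQ).2 ha).resolve_right fun h ↦ hj (mem_varsIn.mpr h))

lemma IsMonomialIdeal.isVarPrimary {Q : Ideal (MvPolynomial (Fin n) K)} (h : IsMonomialIdeal Q)
    (hQ : Q.IsPrimary) : IsVarPrimary Q (varsIn Q.radical) := by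
  simpa only [h.monomialCore_eq] using isVarPrimary_monomialCore hQ

lemma associatedPrimes_quotient_eq {R : Type*} [CommRing R] (I : Ideal R) :
    associatedPrimes R (R ⧸ I) = Submodule.associatedPrimes I := by
  have hcolon (x : R) : (⊥ : Submodule R (R ⧸ I)).colon {Ideal.Quotient.mk I x} =
      Submodule.colon I {x} := by
    ext r
    rw [Submodule.mem_colon_singleton, Submodule.mem_colon_singleton, Submodule.mem_bot,
      smul_eq_mul, ← Ideal.Quotient.eq_zero_iff_mem, map_mul]
    rfl
  ext p
  refine Iff.trans Submodule.isAssociatedPrime_def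
    (Iff.trans (and_congr_right fun _ ↦ ⟨?_, ?_⟩) Submodule.isAssociatedPrime_def.symm)
  · rintro ⟨x, rfl⟩
    obtain ⟨x, rfl⟩ := Ideal.Quotient.mk_surjective x
    exact ⟨x, by rw [hcolon]⟩
  · rintro ⟨x, rfl⟩
    exact ⟨Ideal.Quotient.mk I x, by rw [hcolon]⟩

/-- Every associated prime of a finite intersection of primary ideals is the radical of one of
them. -/
lemma exists_radical_eq_of_mem_associatedPrimes {R ι : Type*} [CommRing R] (T : Finset ι)
    (Q : ι → Ideal R) (hQ : ∀ i ∈ T, (Q i).IsPrimary) {p : Ideal R}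
    (hp : p ∈ Submodule.associatedPrimes (T.inf Q)) : ∃ i ∈ T, (Q i).radical = p := by
  classical
  obtain ⟨hprime, x, rfl⟩ := hp
  have h : (Submodule.colon (T.inf Q) {x}).radical =
      T.inf fun i ↦ (Submodule.colon (Q i) {x}).radical := by
    simp_rw [Submodule.colon_finsetInf, ← Ideal.radicalInfTopHom_apply, map_finset_inf,
      Function.comp_def]
  rw [h] at hprime ⊢
  obtain ⟨i, hi, hix⟩ := Ideal.eq_inf_of_isPrime_inf hprime
  refine ⟨i, hi, ?_⟩
  rw [← hix] at hprime ⊢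
  rw [(hQ i hi).radical_colon_singleton_eq_ite x] at hprime ⊢
  split_ifs at hprime ⊢ with hx
  · exact absurd rfl hprime.ne_top
  · rw [Submodule.colon_univ]

lemma injOn_radical_of_isMinimalPrimaryDecomposition {R : Type*} [CommRing R] {I : Ideal R}
    {t : Finset (Ideal R)} (ht : Submodule.IsMinimalPrimaryDecomposition I t) :
    Set.InjOn Ideal.radical (t : Set (Ideal R)) := fun Q hQ Q' hQ' h ↦
  Submodule.IsMinimalPrimaryDecomposition.injOn _ _ ht hQ hQ'
    (by simpa only [Submodule.colon_univ] using h)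

/-- Every monomial ideal has an irredundant primary decomposition with monomial components: replace
the components of any irredundant primary decomposition by their monomial cores. -/
lemma IsMonomialIdeal.exists_isMonomialDecomposition {I : Ideal (MvPolynomial (Fin n) K)}
    (hI : IsMonomialIdeal I) : ∃ t, IsMonomialDecomposition I t := by
  classical
  obtain ⟨t, ht⟩ : ∃ t : Finset (Ideal (MvPolynomial (Fin n) K)),
      Submodule.IsMinimalPrimaryDecomposition I t :=
    Submodule.IsLasker.exists_isMinimalPrimaryDecomposition
    (Submodule.isLasker (MvPolynomial (Fin n) K) (MvPolynomial (Fin n) K)) I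
  have hcore : ∀ Q ∈ t, IsVarPrimary (monomialCore Q) (varsIn Q.radical) := fun Q hQ ↦
    isVarPrimary_monomialCore (ht.primary hQ)
  have hinf : t.inf monomialCore = I := by
    refine le_antisymm ?_ ?_
    · rw [← ht.inf_eq]
      exact Finset.inf_mono_fun fun Q _ ↦ monomialCore_le Q
    · refine hI.le_of_forall (isMonomialIdeal_finset_inf t _ fun Q hQ ↦ (hcore Q hQ).isMonomial)
        fun a ha ↦ ?_
      rw [← ht.inf_eq] at ha
      rw [Submodule.mem_finsetInf] at ha ⊢
      exact fun Q hQ ↦ monomial_mem_monomialCore_iff.mpr (ha Q hQ)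
  have himage : (t.image monomialCore).inf id = I := by
    rw [Finset.inf_image, Function.id_comp, hinf]
  have hass : ∀ Q ∈ t, Q.radical ∈ Submodule.associatedPrimes I := fun Q hQ ↦ by
    simpa only [Submodule.colon_univ] using ht.mem_associatedPrimes hQ
  have hinj := injOn_radical_of_isMinimalPrimaryDecomposition ht
  -- the associated primes of `I` are generated by variables, so taking cores keeps the radicals
  have hrad : ∀ Q ∈ t, (monomialCore Q).radical = Q.radical := by
    intro Q hQ
    obtain ⟨Q', hQ', h⟩ := exists_radical_eq_of_mem_associatedPrimes t monomialCore
      (fun Q hQ ↦ (hcore Q hQ).isPrimary) (hinf.symm ▸ hass Q hQ)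
    rw [(hcore Q' hQ').radical_eq] at h
    rw [(hcore Q hQ).radical_eq, ← h, varsIn_span_X_image]
  refine ⟨t.image monomialCore, ⟨?_, ?_, ?_, ?_⟩, ?_⟩
  · exact himage
  · intro J hJ
    obtain ⟨Q, hQ, rfl⟩ := Finset.mem_image.mp hJ
    exact (hcore Q hQ).isPrimary
  · intro J hJ J' hJ' hne
    obtain ⟨Q, hQ, rfl⟩ := Finset.mem_image.mp hJ
    obtain ⟨Q', hQ', rfl⟩ := Finset.mem_image.mp hJ'
    intro h
    simp only [Submodule.colon_univ, hrad Q hQ, hrad Q' hQ'] at h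
    exact hne (congrArg monomialCore (hinj hQ hQ' h))
  · intro J hJ hle
    have hI' : ((t.image monomialCore).erase J).inf id = I := by
      refine le_antisymm ?_ (himage ▸ Finset.inf_mono (Finset.erase_subset _ _))
      conv_rhs => rw [← himage, ← Finset.insert_erase hJ, Finset.inf_insert]
      exact le_inf hle le_rfl
    obtain ⟨Q, hQ, rfl⟩ := Finset.mem_image.mp hJ
    obtain ⟨J', hJ', h⟩ := exists_radical_eq_of_mem_associatedPrimes
      ((t.image monomialCore).erase (monomialCore Q)) id (fun J' hJ' ↦ by
        obtain ⟨Q', hQ', rfl⟩ := Finset.mem_image.mp (Finset.mem_of_mem_erase hJ')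
        exact (hcore Q' hQ').isPrimary) (hI'.symm ▸ hass Q hQ)
    obtain ⟨hne, hJ'⟩ := Finset.mem_erase.mp hJ'
    obtain ⟨Q', hQ', rfl⟩ := Finset.mem_image.mp hJ'
    rw [id, hrad Q' hQ'] at h
    exact hne (congrArg monomialCore (hinj hQ' hQ h))
  · intro J hJ
    obtain ⟨Q, -, rfl⟩ := Finset.mem_image.mp hJ
    exact isMonomialIdeal_monomialCore Q

end Primary

end MonomialDepth

/-! ### Heights and the size of a decomposition -/

namespace MonomialDepth

section Size

open MvPolynomial

variable {K : Type*} [Field K] {n : ℕ}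

lemma height_span_X_image (F : Finset (Fin n)) :
    (Ideal.span (X '' (F : Set (Fin n)) : Set (MvPolynomial (Fin n) K))).height = F.card := by
  classical
  apply le_antisymm
  · refine (Ideal.height_le_spanFinrank _ (isPrime_span_X_image F).ne_top).trans ?_
    refine (Nat.cast_le.mpr
      (Submodule.spanFinrank_span_le_ncard_of_finite (F.finite_toSet.image X))).trans ?_
    rw [Nat.cast_le, ← Set.ncard_coe_finset F]
    exact Set.ncard_image_le F.finite_toSet
  · induction F using Finset.induction_on with
    | empty => simp
    | insert j F hj ih =>
      have := isPrime_span_X_image (K := K) F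
      have := isPrime_span_X_image (K := K) (insert j F)
      rw [Finset.card_insert_of_notMem hj, Nat.cast_add, Nat.cast_one]
      refine (add_le_add_left ih 1).trans (Ideal.height_add_one_le_of_lt_of_isPrime ?_)
      refine lt_of_le_not_ge (Ideal.span_mono (Set.image_mono (by simp))) fun h ↦ hj ?_
      exact X_mem_span_X_image_iff.mp (h (X_mem_span_X_image_iff.mpr (by simp)))

lemma IsVarPrimary.height_eq {Q : Ideal (MvPolynomial (Fin n) K)} {F : Finset (Fin n)}
    (h : IsVarPrimary Q F) : Q.height = F.card := by
  rw [← height_span_X_image (K := K), ← h.radical_eq, Ideal.height_eq_inf_minimalPrimes,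
    ← Ideal.radical_minimalPrimes, ← Ideal.height_eq_inf_minimalPrimes]

lemma isVarPrimary_sum {ι : Type*} [DecidableEq ι] (u : Finset ι)
    (Q : ι → Ideal (MvPolynomial (Fin n) K)) (F : ι → Finset (Fin n))
    (h : ∀ i ∈ u, IsVarPrimary (Q i) (F i)) :
    IsVarPrimary (∑ i ∈ u, Q i) (u.biUnion F) := by
  induction u using Finset.induction_on with
  | empty => simpa using isVarPrimary_span_X_image (K := K) (n := n) ∅
  | insert i u hi ih =>
    rw [Finset.sum_insert hi, Finset.biUnion_insert]
    exact (h i (by simp)).sup (ih fun j hj ↦ h j (by simp [hj]))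

/-- If every component involves a variable that the others do not, then no component can be
omitted without changing the radical of the sum. -/
lemma minSpanningNumber_eq_card (t : Finset (Ideal (MvPolynomial (Fin n) K)))
    (F : Ideal (MvPolynomial (Fin n) K) → Finset (Fin n)) (hQ : ∀ Q ∈ t, IsVarPrimary Q (F Q))
    (hF : ∀ Q ∈ t, ∃ y ∈ F Q, ∀ Q' ∈ t, Q' ≠ Q → y ∉ F Q') :
    minSpanningNumber t = t.card := by
  classical
  rcases t.eq_empty_or_nonempty with rfl | hne
  · -- without components there is no nonempty subfamily, and the infimum of the empty set is `0`
    rw [minSpanningNumber, Finset.card_empty, Nat.sInf_eq_zero]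
    refine Or.inr (Set.eq_empty_of_forall_notMem ?_)
    rintro m ⟨u, hu, hu', -⟩
    exact hu'.ne_empty (Finset.subset_empty.mp hu)
  · have hmem : t.card ∈ {m : ℕ | ∃ u : Finset (Ideal (MvPolynomial (Fin n) K)), u ⊆ t ∧
        u.Nonempty ∧ u.card = m ∧ (∑ Q ∈ u, Q).radical = (∑ Q ∈ t, Q).radical} :=
      ⟨t, subset_rfl, hne, rfl, rfl⟩
    refine le_antisymm (Nat.sInf_le hmem) (le_csInf ⟨_, hmem⟩ ?_)
    rintro _ ⟨u, hut, -, rfl, hu⟩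
    rw [(isVarPrimary_sum u (fun Q ↦ Q) F fun Q h ↦ hQ Q (hut h)).radical_eq,
      (isVarPrimary_sum t (fun Q ↦ Q) F hQ).radical_eq] at hu
    refine Finset.card_le_card fun Q h ↦ ?_
    obtain ⟨y, hy, hy'⟩ := hF Q h
    have hyu : (X y : MvPolynomial (Fin n) K) ∈
        Ideal.span (X '' ((u.biUnion F : Finset (Fin n)) : Set (Fin n))) :=
      hu ▸ X_mem_span_X_image_iff.mpr (Finset.mem_biUnion.mpr ⟨Q, h, hy⟩)
    obtain ⟨Q', hQ'u, hQ'⟩ := Finset.mem_biUnion.mp (X_mem_span_X_image_iff.mp hyu)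
    by_contra hQu
    exact hy' Q' (hut hQ'u) (fun h ↦ hQu (h ▸ hQ'u)) hQ'

lemma decompositionSize_eq (t : Finset (Ideal (MvPolynomial (Fin n) K)))
    (F : Ideal (MvPolynomial (Fin n) K) → Finset (Fin n)) (hQ : ∀ Q ∈ t, IsVarPrimary Q (F Q))
    (hF : ∀ Q ∈ t, ∃ y ∈ F Q, ∀ Q' ∈ t, Q' ≠ Q → y ∉ F Q') :
    decompositionSize t = (t.card : ℤ) - 1 + ((n : ℤ) - ((t.biUnion F).card : ℤ)) := by
  classical
  rw [decompositionSize, minSpanningNumber_eq_card t F hQ hF,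
    (isVarPrimary_sum t (fun Q ↦ Q) F hQ).height_eq, ENat.toNat_natCast]
  ring

variable {I : Ideal (MvPolynomial (Fin n) K)} {t : Finset (Ideal (MvPolynomial (Fin n) K))}

lemma IsMonomialDecomposition.isVarPrimary (ht : IsMonomialDecomposition I t) :
    ∀ Q ∈ t, IsVarPrimary Q (varsIn Q.radical) := fun Q hQ ↦
  (ht.isMonomial Q hQ).isVarPrimary (ht.isMinimal.primary hQ)

lemma IsMonomialDecomposition.image_radical_eq (ht : IsMonomialDecomposition I t) :
    Ideal.radical '' (t : Set (Ideal (MvPolynomial (Fin n) K))) =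
      associatedPrimes (MvPolynomial (Fin n) K) (MvPolynomial (Fin n) K ⧸ I) := by
  rw [associatedPrimes_quotient_eq, ← ht.isMinimal.image_radical_eq_associated_primes]
  exact Set.image_congr fun Q _ ↦ by rw [Submodule.colon_univ]

variable {s : ℕ} {P : Fin s → Ideal (MvPolynomial (Fin n) K)}

lemma IsMonomialDecomposition.exists_eq_radical (ht : IsMonomialDecomposition I t)
    (hAss : associatedPrimes (MvPolynomial (Fin n) K) (MvPolynomial (Fin n) K ⧸ I) = Set.range P)
    {Q : Ideal (MvPolynomial (Fin n) K)} (hQ : Q ∈ t) : ∃ i, P i = Q.radical := by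
  rw [← Set.mem_range, ← hAss, ← ht.image_radical_eq]
  exact Set.mem_image_of_mem _ hQ

lemma IsMonomialDecomposition.card_eq (ht : IsMonomialDecomposition I t)
    (hAss : associatedPrimes (MvPolynomial (Fin n) K) (MvPolynomial (Fin n) K ⧸ I) = Set.range P)
    (hP : Function.Injective P) : t.card = s := by
  rw [← Set.ncard_coe_finset t,
    ← (injOn_radical_of_isMinimalPrimaryDecomposition ht.isMinimal).ncard_image,
    ht.image_radical_eq, hAss, ← Set.image_univ, Set.ncard_image_of_injective _ hP,
    Set.ncard_univ, Nat.card_fin]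

/-- The hypothesis on the associated primes in terms of variables: the radical of each component
contains a variable that is not in the radicals of the others. -/
lemma IsMonomialDecomposition.exists_mem_varsIn (ht : IsMonomialDecomposition I t)
    (hAss : associatedPrimes (MvPolynomial (Fin n) K) (MvPolynomial (Fin n) K ⧸ I) = Set.range P)
    (hP : ∀ i : Fin s, ¬ P i ≤ ∑ j ∈ Finset.univ.erase i, P j) :
    ∀ Q ∈ t, ∃ y ∈ varsIn Q.radical, ∀ Q' ∈ t, Q' ≠ Q → y ∉ varsIn Q'.radical := by
  intro Q hQ
  obtain ⟨i, hi⟩ := ht.exists_eq_radical hAss hQ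
  by_contra! hcon
  refine hP i ?_
  rw [hi, (ht.isVarPrimary Q hQ).radical_eq, Ideal.span_le]
  rintro _ ⟨y, hy, rfl⟩
  obtain ⟨Q', hQ', hne, hy'⟩ := hcon y hy
  obtain ⟨j, hj⟩ := ht.exists_eq_radical hAss hQ'
  have hji : j ≠ i := by
    rintro rfl
    exact hne 
      (injOn_radical_of_isMinimalPrimaryDecomposition ht.isMinimal hQ' hQ (hj.symm.trans hi))
  rw [Ideal.sum_eq_sup]
  exact Finset.le_sup (f := P) (Finset.mem_erase.mpr ⟨hji, Finset.mem_univ j⟩)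
    (hj ▸ mem_varsIn.mp hy')

lemma IsMonomialDecomposition.sum_associatedPrimes_eq (ht : IsMonomialDecomposition I t)
    (hAss : associatedPrimes (MvPolynomial (Fin n) K) (MvPolynomial (Fin n) K ⧸ I) = Set.range P) :
    ∑ i, P i = Ideal.span
      (X '' ((t.biUnion fun Q ↦ varsIn Q.radical : Finset (Fin n)) : Set (Fin n))) := by
  rw [Ideal.sum_eq_sup]
  refine le_antisymm (Finset.sup_le fun i _ ↦ ?_) ?_
  · obtain ⟨Q, hQ, hi⟩ : P i ∈ Ideal.radical '' (t : Set (Ideal (MvPolynomial (Fin n) K))) := by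
      rw [ht.image_radical_eq, hAss]
      exact Set.mem_range_self i
    rw [← hi, (ht.isVarPrimary Q hQ).radical_eq]
    refine Ideal.span_mono (Set.image_mono fun y hy ↦ ?_)
    exact Finset.mem_biUnion.mpr ⟨Q, hQ, hy⟩
  · rw [Ideal.span_le]
    rintro _ ⟨y, hy, rfl⟩
    obtain ⟨Q, hQ, hy⟩ := Finset.mem_biUnion.mp hy
    obtain ⟨i, hi⟩ := ht.exists_eq_radical hAss hQ
    exact Finset.le_sup (f := P) (Finset.mem_univ i) (hi ▸ mem_varsIn.mp hy)

end Size

/-! ### Depth of the ideal -/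

section DepthOfIdeal

open CategoryTheory Abelian MvPolynomial

universe u

variable {K : Type u} [Field K] {n : ℕ}
  {I : Ideal (MvPolynomial (Fin n) K)} {t : Finset (Ideal (MvPolynomial (Fin n) K))}

/-- For the unit ideal, where `t` is empty, this is the depth `n` of the polynomial ring. -/
lemma IsMonomialDecomposition.depth_eq (ht : IsMonomialDecomposition I t)
    (hF : ∀ Q ∈ t, ∃ y ∈ varsIn Q.radical, ∀ Q' ∈ t, Q' ≠ Q → y ∉ varsIn Q'.radical) :
    depth (K := K) (n := n) I =
      ((t.card + (n - (t.biUnion fun Q ↦ varsIn Q.radical).card) : ℕ) : ℕ∞) := by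
  classical
  have hinf : t.inf id = I := ht.isMinimal.inf_eq
  have hI : I ≠ ⊥ := by
    intro h0
    have hprod : ∏ Q ∈ t, Q = 0 := by
      rw [Submodule.zero_eq_bot, ← le_bot_iff, ← h0, ← hinf]
      exact Ideal.prod_le_inf
    obtain ⟨Q, hQ, hQ0⟩ := Finset.prod_eq_zero_iff.mp hprod
    obtain ⟨y, hy, -⟩ := hF Q hQ
    obtain ⟨k, hk⟩ := (ht.isVarPrimary Q hQ).pow_mem y hy
    rw [hQ0] at hk
    exact pow_ne_zero k (X_ne_zero y) hk
  refine HasExtGrade.depth_eq _ (idealOfVars_smul_top_lt_top hI) ?_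
  rcases t.eq_empty_or_nonempty with rfl | hne
  · obtain rfl : ⊤ = I := by simpa using hinf
    simpa using hasExtGrade_self.congr Submodule.topEquiv.symm
  · rw [← hinf]
    refine hasExtGrade_finset_inf t hne id (fun Q ↦ varsIn Q.radical) ht.isVarPrimary hF ?_
    have := Finset.card_le_univ (t.biUnion fun Q ↦ varsIn Q.radical)
    rw [Fintype.card_fin] at this
    omega

end DepthOfIdeal

end MonomialDepth

theorem corollaryp {K : Type*} [Field K] (n : ℕ)
    (I : Ideal (MvPolynomial (Fin n) K)) (hI : MonomialDepth.IsMonomialIdeal I)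
    (s : ℕ) (P : Fin s → Ideal (MvPolynomial (Fin n) K))
    (hAss : associatedPrimes (MvPolynomial (Fin n) K) (MvPolynomial (Fin n) K ⧸ I) = Set.range P)
    (hP : ∀ i : Fin s, ¬ P i ≤ ∑ j ∈ Finset.univ.erase i, P j) :
    -- the size is well defined
    (∃ t, MonomialDepth.IsMonomialDecomposition I t) ∧
    (∀ t, MonomialDepth.IsMonomialDecomposition I t →
      MonomialDepth.decompositionSize t = MonomialDepth.size I) ∧
    -- size and depth, with `b` the height of the sum of the associated primes
    (∃ b : ℕ, (∑ i, P i).height = b ∧ b ≤ n ∧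
      MonomialDepth.size I = (s : ℤ) - 1 + ((n : ℤ) - (b : ℤ)) ∧
      MonomialDepth.depth (K := K) (n := n) I = ((s + (n - b) : ℕ) : ℕ∞)) ∧
    -- the normalized case, in which that sum is the graded maximal ideal
    (∑ i, P i = MvPolynomial.idealOfVars (Fin n) K →
      MonomialDepth.size I = (s : ℤ) - 1 ∧
      MonomialDepth.depth (K := K) (n := n) I = (s : ℕ∞)) ∧
    MonomialDepth.HasMinimalDepth I := by
  classical
  have hex := hI.exists_isMonomialDecomposition
  have hinj : Function.Injective P := by
    intro i j hij
    by_contra hne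
    refine hP i ?_
    rw [hij, Ideal.sum_eq_sup]
    exact Finset.le_sup (f := P) (Finset.mem_erase.mpr ⟨Ne.symm hne, Finset.mem_univ j⟩)
  obtain ⟨b, hb⟩ : ∃ b : ℕ, (∑ i, P i).height = b := by
    obtain ⟨t, ht⟩ := hex
    rw [ht.sum_associatedPrimes_eq hAss]
    exact ⟨_, MonomialDepth.height_span_X_image _⟩
  -- the number `b` is the number of variables in the radicals of any decomposition
  have hcard : ∀ t, MonomialDepth.IsMonomialDecomposition I t →
      (t.biUnion fun Q ↦ MonomialDepth.varsIn Q.radical).card = b := fun t ht ↦ by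
    rw [ht.sum_associatedPrimes_eq hAss, MonomialDepth.height_span_X_image] at hb
    exact_mod_cast hb
  have hdec : ∀ t, MonomialDepth.IsMonomialDecomposition I t →
      MonomialDepth.decompositionSize t = (s : ℤ) - 1 + ((n : ℤ) - (b : ℤ)) := fun t ht ↦ by
    rw [MonomialDepth.decompositionSize_eq t _ ht.isVarPrimary (ht.exists_mem_varsIn hAss hP),
      hcard t ht, ht.card_eq hAss hinj]
  have hsize : MonomialDepth.size I = (s : ℤ) - 1 + ((n : ℤ) - (b : ℤ)) := by
    rw [MonomialDepth.size, dif_pos hex]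
    exact hdec _ hex.choose_spec
  have hbn : b ≤ n := by
    obtain ⟨t, ht⟩ := hex
    rw [← hcard t ht]
    simpa using Finset.card_le_univ (t.biUnion fun Q ↦ MonomialDepth.varsIn Q.radical)
  have hdepth : MonomialDepth.depth (K := K) (n := n) I = ((s + (n - b) : ℕ) : ℕ∞) := by
    obtain ⟨t, ht⟩ := hex
    rw [ht.depth_eq (ht.exists_mem_varsIn hAss hP), hcard t ht, ht.card_eq hAss hinj]
  refine ⟨hex, fun t ht ↦ (hdec t ht).trans hsize.symm, ⟨b, hb, hbn, hsize, hdepth⟩, ?_,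
    s + (n - b), hdepth, ?_⟩
  · intro hm
    have hbn' : b = n := by
      have h := MonomialDepth.height_span_X_image (K := K) (Finset.univ : Finset (Fin n))
      rw [Finset.coe_univ, Set.image_univ, ← MvPolynomial.idealOfVars, ← hm, hb,
        Finset.card_univ, Fintype.card_fin] at h
      exact_mod_cast h
    subst hbn'
    exact ⟨by rw [hsize]; ring, by rw [hdepth, Nat.sub_self, add_zero]⟩
  · rw [hsize]
    push_cast [hbn]
    ring
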